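/- Write $\mathbb I=[0,1]$ and let $f:\mathbb I\to\mathbb I$ be the doubling map, $f(x)=2x$ for $x\le 1/2$ and $f(x)=2x-1$ for $x>1/2$. For $i=1,2$ and $\beta\in(0,1)$ let $g_{i,\beta}:\mathbb I\to\mathbb I$ be a $C^2$ diffeomorphism such that (I1) $g_{i,\beta}(0)=0$, $g_{i,\beta}(1)=1$, $g_{i,\beta}(\beta)=\beta$; (I2) $g_{1,\beta}(y)<y$ for $0<y<\beta$ and $g_{1,\beta}(y)>y$ for $\beta<y<1$; (I3) $g_{2,\beta}(y)>y$ for $0<y<\beta$ and $g_{2,\beta}(y)<y$ for $\beta<y<1$; and such that, for $i=1,2$ and $j=0,1$, the derivative $g_{i,\beta}'(j)$ is a $C^\infty$ function of $\beta\in(0,1)$. For $\beta_1,\beta_2\in(0,1)$ let $F_{\beta_1,\beta_2}:\mathbb I^2\to\mathbb I^2$, $F_{\beta_1,\beta_2}(x,y)=(f(x),g_{1,\beta_1}(y))$ if $x\le 1/2$ and $(f(x),g_{2,\beta_2}(y))$ if $x>1/2$. Put $A_j=\mathbb I\times\{j\}$ and $\alpha^j_{\beta_1\beta_2}=g_{1,\beta_1}'(j)\,g_{2,\beta_2}'(j)$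 for $j=0,1$. Terminology, for a map $F$ of $M=\mathbb I^2$ with Lebesgue measure $m$ and a compact set $A$ with $F(A)=A$. The basin $\mathcal B(A)$ is the set of points whose $\omega$-limit set (the set of limit points of the forward orbit) is contained in $A$. $A$ is a Milnor attractor if $m(\mathcal B(A))>0$ and no compact proper subset $A'\subsetneq A$ has a basin equal to $\mathcal B(A)$ up to measure zero. $A$ is an essential attractor if $m(B_\delta(A)\cap\mathcal B(A))/m(B_\delta(A))\to 1$ as $\delta\to0^+$, where $B_\delta(A)$ is the $\delta$-neighbourhood of $A$. A Milnor attractor $A$ has a locally riddled basin if there is a neighbourhood $U$ of $A$ with $m\big(B_\varepsilon(x)\cap(\bigcap_{n\ge0}F^{-n}(U))^c\big)>0$ for all $x\in A$, $\varepsilon>0$. $A$ is a chaotic saddle if it is transitive (some $x\in A$ has $\omega$-limit set equal to $A$), some neighbourhood $U$ of $A$ satisfies $\mathcal B(A)\cap U\ne\emptyset$, and $m(\mathcal B(A))=0$. A function on $(0,1)$ changes sign from negative to positive if for some $s\in(0,1)$ it is negative on $(0,s)$ and positive on $(s,1)$; similarly from positive to negative. **Theorem.** (a) Let $\beta_1^r\in(0,1)$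 be such that for each $\beta_1\in(0,\beta_1^r)$ the sign of $\beta_2\mapsto\log\alpha^0_{\beta_1\beta_2}$ changes from negative to positive on $(0,1)$. Then there is a function $\xi$ on $(0,\beta_1^r]$ with $\xi(\beta_1^r)=1$, with values in $(0,1)$ on $(0,\beta_1^r)$ and continuous there, such that, for all $\beta_1\in(0,\beta_1^r)$ and $\beta_2\in(0,1)$: (i) if $\beta_2<\xi(\beta_1)$, then $A_0$ is a Milnor attractor and an essential attractor of $F_{\beta_1,\beta_2}$ and has a locally riddled basin; (ii) if $\beta_2>\xi(\beta_1)$, then $A_0$ is a chaotic saddle of $F_{\beta_1,\beta_2}$. Moreover $\xi$ is $C^\infty$ near every $\beta_1\in(0,\beta_1^r)$ at which the sign change is non-degenerate, that is, $\partial_{\beta_2}\log\alpha^0_{\beta_1\beta_2}\ne0$ at $\beta_2=\xi(\beta_1)$; and if $\beta_1^r$ is the end of the range of sign changes in the sense that $\log\alpha^0_{\beta_1^r\beta_2}<0$ for all $\beta_2\in(0,1)$, then $\xi$ is also continuous at $\beta_1^r$, i.e. $\xi(\beta_1)\to1$ as $\beta_1\uparrow\beta_1^r$. (b) Let $\beta_1^\ell\in(0,1)$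 be such that for each $\beta_1\in(\beta_1^\ell,1)$ the sign of $\beta_2\mapsto\log\alpha^1_{\beta_1\beta_2}$ changes from positive to negative on $(0,1)$. Then there is a function $\zeta$ on $[\beta_1^\ell,1)$ with $\zeta(\beta_1^\ell)=0$, with values in $(0,1)$ on $(\beta_1^\ell,1)$ and continuous there, such that, for all $\beta_1\in(\beta_1^\ell,1)$ and $\beta_2\in(0,1)$: (i) if $\beta_2>\zeta(\beta_1)$, then $A_1$ is a Milnor attractor and an essential attractor of $F_{\beta_1,\beta_2}$ and has a locally riddled basin; (ii) if $\beta_2<\zeta(\beta_1)$, then $A_1$ is a chaotic saddle of $F_{\beta_1,\beta_2}$. Moreover $\zeta$ is $C^\infty$ near every $\beta_1\in(\beta_1^\ell,1)$ with $\partial_{\beta_2}\log\alpha^1_{\beta_1\beta_2}\ne0$ at $\beta_2=\zeta(\beta_1)$; and if $\log\alpha^1_{\beta_1^\ell\beta_2}<0$ for all $\beta_2\in(0,1)$, then $\zeta$ is also continuous at $\beta_1^\ell$, i.e. $\zeta(\beta_1)\to0$ as $\beta_1\downarrow\beta_1^\ell$. -/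

import Mathlib

open Set Filter Topology MeasureTheory unitInterval
open scoped ContDiff

namespace RiddledSkew

section Attractors

variable {X : Type*}

/-- The `ω`-limit set of `x`: all limit points of the orbit `x, F x, F (F x), …`. -/
def omegaSet [TopologicalSpace X] (F : X → X) (x : X) : Set X :=
  omegaLimit atTop (fun n : ℕ => F^[n]) {x}

/-- The basin of attraction of `A`: all points whose `ω`-limit set is contained in `A`. -/
def basin [TopologicalSpace X] (F : X → X) (A : Set X) : Set X :=
  {x | omegaSet F x ⊆ A}

/-- `A` is compact and `F`-invariant, `F(A) = A`. -/
def IsCompactInvariant [TopologicalSpace X] (F : X → X) (A : Set X) : Prop :=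
  IsCompact A ∧ F '' A = A

/-- `A` is transitive: some point of `A` has `A` as its `ω`-limit set. -/
def IsTransitiveSet [TopologicalSpace X] (F : X → X) (A : Set X) : Prop :=
  ∃ x ∈ A, omegaSet F x = A

/-- Milnor attractor: the basin has non-zero measure, and no compact proper subset `A'` of `A`
has a basin that agrees with the basin of `A` up to measure zero. -/
def IsMilnorAttractor [TopologicalSpace X] [MeasureSpace X] (F : X → X) (A : Set X) : Prop :=
  IsCompactInvariant F A ∧ volume (basin F A) ≠ 0 ∧
    ∀ A' : Set X, IsCompact A' → A' ⊂ A → ¬ (basin F A' =ᵐ[volume] basin F A)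

/-- Essential attractor: `m (B_δ(A) ∩ basin A) / m (B_δ(A)) → 1` as `δ → 0`, where `B_δ(A)` is the
`δ`-neighbourhood of `A`. -/
def IsEssentialAttractor [PseudoMetricSpace X] [MeasureSpace X] (F : X → X) (A : Set X) : Prop :=
  IsCompactInvariant F A ∧
    Tendsto (fun δ : ℝ => volume (Metric.thickening δ A ∩ basin F A) /
      volume (Metric.thickening δ A)) (𝓝[>] 0) (𝓝 1)

/-- The Milnor attractor `A` has a locally riddled basin: for some neighbourhood `U` of `A`, in every
ball around every point of `A` the points whose forward orbit leaves `U` at some time have positive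
measure. -/
def HasLocallyRiddledBasin [PseudoMetricSpace X] [MeasureSpace X] (F : X → X) (A : Set X) : Prop :=
  IsMilnorAttractor F A ∧
    ∃ U ∈ 𝓝ˢ A, ∀ x ∈ A, ∀ ε > 0,
      0 < volume (Metric.ball x ε ∩ (⋂ n : ℕ, F^[n] ⁻¹' U)ᶜ)

/-- Chaotic saddle: a compact invariant transitive set with a neighbourhood that meets the basin,
whose basin nevertheless has measure zero. -/
def IsChaoticSaddle [TopologicalSpace X] [MeasureSpace X] (F : X → X) (A : Set X) : Prop :=
  IsCompactInvariant F A ∧ IsTransitiveSet F A ∧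
    ∃ U ∈ 𝓝ˢ A, (basin F A ∩ U).Nonempty ∧ volume (basin F A) = 0

end Attractors

/-- The doubling map of `[0,1]`: `2x` for `x ≤ 1/2` and `2x - 1` for `x > 1/2`. -/
noncomputable def doubling (x : I) : I :=
  if h : (x : ℝ) ≤ 1 / 2 then ⟨2 * (x : ℝ), by constructor <;> linarith [x.2.1]⟩
  else ⟨2 * (x : ℝ) - 1, by constructor <;> linarith [x.2.2]⟩

/-- The skew product over the doubling map on the unit square, with fiber map `g₁` over `[0,1/2]`
and `g₂` over `(1/2,1]`. -/
noncomputable def skewProduct (g₁ g₂ : I → I) (p : I × I) : I × I :=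
  (doubling p.1, if (p.1 : ℝ) ≤ 1 / 2 then g₁ p.2 else g₂ p.2)

/-- The horizontal segment `[0,1] × {j}`. -/
def segmentAt (j : I) : Set (I × I) := univ ×ˢ {j}

/-- A self-map of `[0,1]` as a real function on `ℝ` (constant to the left of `0` and to the right of
`1`; only its values on `[0,1]` are used). -/
noncomputable def realExt (g : I → I) : ℝ → ℝ :=
  IccExtend (zero_le_one (α := ℝ)) (fun y => (g y : ℝ))

/-- A bijection of `[0,1]` that is a `C²` diffeomorphism (one-sided derivatives at the ends). -/
def IsC2Diffeo (g : I ≃ I) : Prop :=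
  ContDiffOn ℝ 2 (realExt g) (Icc 0 1) ∧ ContDiffOn ℝ 2 (realExt g.symm) (Icc 0 1)

/-- The derivative of a self-map of `[0,1]` at `j` (one-sided at the ends). -/
noncomputable def fiberDeriv (g : I → I) (j : I) : ℝ :=
  derivWithin (realExt g) (Icc 0 1) (j : ℝ)

/-- A family `g_β`, `0 < β < 1`, of `C²` diffeomorphisms of `[0,1]` fixing `0`, `1` and `β`, whose
derivatives at `0` and at `1` depend smoothly on the parameter `β`. -/
structure IsFiberFamily (g : ℝ → (I ≃ I)) : Prop where
  diffeo : ∀ β ∈ Ioo (0 : ℝ) 1, IsC2Diffeo (g β)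
  fix_zero : ∀ β ∈ Ioo (0 : ℝ) 1, g β 0 = 0
  fix_one : ∀ β ∈ Ioo (0 : ℝ) 1, g β 1 = 1
  fix_param : ∀ β ∈ Ioo (0 : ℝ) 1, ∀ y : I, (y : ℝ) = β → g β y = y
  smooth_zero : ContDiffOn ℝ ∞ (fun β => fiberDeriv (g β) 0) (Ioo 0 1)
  smooth_one : ContDiffOn ℝ ∞ (fun β => fiberDeriv (g β) 1) (Ioo 0 1)

/-- Every `g_β` moves points of `(0,β)` down and points of `(β,1)` up. -/
def RepelsFromParam (g : ℝ → (I ≃ I)) : Prop :=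
  ∀ β ∈ Ioo (0 : ℝ) 1, ∀ y : I,
    (0 < (y : ℝ) → (y : ℝ) < β → g β y < y) ∧ (β < (y : ℝ) → (y : ℝ) < 1 → y < g β y)

/-- Every `g_β` moves points of `(0,β)` up and points of `(β,1)` down. -/
def AttractsToParam (g : ℝ → (I ≃ I)) : Prop :=
  ∀ β ∈ Ioo (0 : ℝ) 1, ∀ y : I,
    (0 < (y : ℝ) → (y : ℝ) < β → y < g β y) ∧ (β < (y : ℝ) → (y : ℝ) < 1 → g β y < y)

/-- `log α^j`, where `α^j = g₁'(j) g₂'(j)` for the parameters `β₁`, `β₂`. -/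
noncomputable def logAlpha (g₁ g₂ : ℝ → (I ≃ I)) (j : I) (β₁ β₂ : ℝ) : ℝ :=
  Real.log (fiberDeriv (g₁ β₁) j * fiberDeriv (g₂ β₂) j)

/-- The sign of `φ` changes from negative to positive as the variable runs through `(0,1)`. -/
def ChangesNegToPos (φ : ℝ → ℝ) : Prop :=
  ∃ s ∈ Ioo (0 : ℝ) 1, (∀ t ∈ Ioo 0 s, φ t < 0) ∧ ∀ t ∈ Ioo s 1, 0 < φ t

/-- The sign of `φ` changes from positive to negative as the variable runs through `(0,1)`. -/
def ChangesPosToNeg (φ : ℝ → ℝ) : Prop :=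
  ∃ s ∈ Ioo (0 : ℝ) 1, (∀ t ∈ Ioo 0 s, 0 < φ t) ∧ ∀ t ∈ Ioo s 1, φ t < 0

end RiddledSkew

open RiddledSkew

open RiddledSkew

/-! Under Lebesgue measure the binary digits of the base point are independent fair coins. Near
height `j` a step multiplies the distance to the segment by about `|g₁'(j)|` or `|g₂'(j)|`,
according to the digit, so the logarithm of the distance behaves like a random walk with drift `(log
α^j) / 2`. By the strong law of large numbers (`ae_tendsto_average_halfStep`), negative drift puts a
fibre neighbourhood of the segment into the basin over almost every base point
(`exists_fiber_ball_subset_basin`), while positive drift excludes convergence from off the segment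
(`notMem_basin_of_pos`), so the basin is null. Almost every base orbit is dense, hence no proper
compact subset of the segment captures the basin.

Riddling holds because `g₂` pushes points away from both ends of the fibre: a long enough block of
right-half digits, which has positive probability inside every cylinder, drives an orbit out of a
fixed strip.

The curves `ξ` and `ζ` come from `log α^j = u(β₁) + v(β₂)` (`exists_sign_boundary`). Strict
inequalities persist under small changes of `β₁`, which makes the sign boundary continuous; where
`v' ≠ 0`, the inverse function theorem makes it smooth. -/

namespace RiddledSkew

open ProbabilityTheory

/-! ### The doubling map and Lebesgue measure. -/

/-- The left half `[0,1/2]` of the unit interval. -/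
def leftHalf : Set I := {x | (x : ℝ) ≤ 1 / 2}

theorem measurableSet_leftHalf : MeasurableSet leftHalf :=
  measurableSet_le measurable_subtype_coe measurable_const

theorem doubling_coe_of_le {x : I} (h : (x : ℝ) ≤ 1 / 2) : (doubling x : ℝ) = 2 * x := by
  simp only [doubling, dif_pos h]

theorem doubling_coe_of_gt {x : I} (h : ¬ (x : ℝ) ≤ 1 / 2) : (doubling x : ℝ) = 2 * x - 1 := by
  simp only [doubling, dif_neg h]

theorem measurable_doubling : Measurable doubling := by
  have h : Measurable fun x : I => if (x : ℝ) ≤ 1 / 2 then 2 * (x : ℝ) else 2 * (x : ℝ) - 1 :=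
    Measurable.ite measurableSet_leftHalf (by fun_prop) (by fun_prop)
  have h' : (fun x : I => (doubling x : ℝ)) =
      fun x : I => if (x : ℝ) ≤ 1 / 2 then 2 * (x : ℝ) else 2 * (x : ℝ) - 1 := by
    funext x
    split_ifs with hx
    · exact doubling_coe_of_le hx
    · exact doubling_coe_of_gt hx
  have h2 : Measurable fun x : I => (doubling x : ℝ) := h' ▸ h
  exact h2.subtype_mk (h := fun x => (doubling x).2)

/-- The inverse branches of `doubling` are the homotheties of ratio `1/2` centred at `0` and at `1`.
The scaling formula needs no measurability of `S`, so the digit computations below hold for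
arbitrary sets. -/
theorem volume_image_homothety_half (c : ℝ) (S : Set ℝ) :
    volume (AffineMap.homothety c (1 / 2 : ℝ) '' S) = 2⁻¹ * volume S := by
  rw [Measure.addHaar_image_homothety]
  congr 1
  simp [abs_of_pos]

theorem volume_leftHalf_inter_preimage (S : Set I) :
    volume (leftHalf ∩ doubling ⁻¹' S) = 2⁻¹ * volume S := by
  rw [unitInterval.volume_apply, unitInterval.volume_apply (s := S),
    ← volume_image_homothety_half 0]
  congr 1
  ext t
  simp only [mem_image, mem_inter_iff, mem_preimage, AffineMap.homothety_apply, vsub_eq_sub,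
    smul_eq_mul, vadd_eq_add]
  constructor
  · rintro ⟨x, ⟨hx, hS⟩, rfl⟩
    exact ⟨_, ⟨_, hS, rfl⟩, by rw [doubling_coe_of_le hx]; ring⟩
  · rintro ⟨_, ⟨y, hy, rfl⟩, rfl⟩
    have h0 := y.2.1
    have h1 := y.2.2
    let x : I := ⟨1 / 2 * ((y : ℝ) - 0) + 0, by constructor <;> linarith⟩
    have hx : (x : ℝ) ≤ 1 / 2 := by simp only [x]; linarith
    refine ⟨x, ⟨hx, ?_⟩, rfl⟩
    have : doubling x = y := Subtype.ext (by rw [doubling_coe_of_le hx]; simp only [x]; ring)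
    rwa [this]

theorem volume_leftHalf_compl_inter_preimage (S : Set I) :
    volume (leftHalfᶜ ∩ doubling ⁻¹' S) = 2⁻¹ * volume S := by
  -- The right half is `(1/2,1]`, so its image under `doubling` misses `0`; that point is discarded.
  have hS : volume S = volume (S \ {0}) := (measure_sdiff_null (measure_singleton _)).symm
  rw [hS, unitInterval.volume_apply, unitInterval.volume_apply (s := S \ {0}),
    ← volume_image_homothety_half 1]
  congr 1
  ext t
  simp only [mem_image, mem_inter_iff, mem_preimage, AffineMap.homothety_apply, vsub_eq_sub,
    smul_eq_mul, vadd_eq_add, mem_compl_iff, Set.mem_sdiff, mem_singleton_iff]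
  constructor
  · rintro ⟨x, ⟨hx, hS⟩, rfl⟩
    have hd := doubling_coe_of_gt hx
    refine ⟨_, ⟨_, ⟨hS, fun h0 => hx ?_⟩, rfl⟩, by rw [hd]; ring⟩
    change (x : ℝ) ≤ 1 / 2
    rw [h0] at hd
    simp only [Icc.coe_zero] at hd
    linarith
  · rintro ⟨_, ⟨y, ⟨hy, hy0⟩, rfl⟩, rfl⟩
    have h0 := unitInterval.pos_iff_ne_zero.2 hy0
    have h0' : (0 : ℝ) < y := h0
    have h1 := y.2.2
    let x : I := ⟨1 / 2 * ((y : ℝ) - 1) + 1, by constructor <;> linarith⟩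
    have hx : ¬ (x : ℝ) ≤ 1 / 2 := by simp only [x]; linarith
    refine ⟨x, ⟨hx, ?_⟩, rfl⟩
    have : doubling x = y := Subtype.ext (by rw [doubling_coe_of_gt hx]; simp only [x]; ring)
    rwa [this]

theorem volume_preimage_doubling (S : Set I) : volume (doubling ⁻¹' S) = volume S := by
  rw [← measure_inter_add_sdiff (doubling ⁻¹' S) measurableSet_leftHalf, inter_comm, sdiff_eq,
    inter_comm (doubling ⁻¹' S), volume_leftHalf_inter_preimage,
    volume_leftHalf_compl_inter_preimage, ← add_mul, ENNReal.inv_two_add_inv_two, one_mul]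

theorem measurePreserving_doubling : MeasurePreserving doubling volume volume :=
  ⟨measurable_doubling, by
    ext S hS
    rw [Measure.map_apply measurable_doubling hS, volume_preimage_doubling]⟩

theorem volume_leftHalf : volume leftHalf = 2⁻¹ := by
  simpa using volume_leftHalf_inter_preimage univ

theorem volume_leftHalf_compl : volume leftHalfᶜ = 2⁻¹ := by
  simpa using volume_leftHalf_compl_inter_preimage univ

theorem surjective_doubling : Function.Surjective doubling := by
  intro y
  have h0 := y.2.1
  have h1 := y.2.2
  let x : I := ⟨1 / 2 * (y : ℝ), by constructor <;> linarith⟩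
  have hx : (x : ℝ) ≤ 1 / 2 := by simp only [x]; linarith
  exact ⟨x, Subtype.ext (by rw [doubling_coe_of_le hx]; simp only [x]; ring)⟩

/-! ### Independence of the digits and the law of large numbers. -/

/-- The function with value `p` on the left half and `q` on the right half of `[0,1]`. -/
noncomputable def halfStep (p q : ℝ) (x : I) : ℝ := if (x : ℝ) ≤ 1 / 2 then p else q

theorem measurable_halfStep (p q : ℝ) : Measurable (halfStep p q) :=
  Measurable.ite measurableSet_leftHalf measurable_const measurable_const

/-- One digit generates only these four events, so independence is checked on each of them. -/
theorem halfStep_preimage (p q : ℝ) (A : Set ℝ) :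
    halfStep p q ⁻¹' A = ∅ ∨ halfStep p q ⁻¹' A = leftHalf ∨ halfStep p q ⁻¹' A = leftHalfᶜ ∨
      halfStep p q ⁻¹' A = univ := by
  by_cases hp : p ∈ A <;> by_cases hq : q ∈ A
  · refine Or.inr (Or.inr (Or.inr ?_))
    ext x
    by_cases hx : (x : ℝ) ≤ 1 / 2 <;>
      simp only [halfStep, mem_preimage, hx, if_true, if_false, hp, hq, mem_univ]
  · refine Or.inr (Or.inl ?_)
    ext x
    by_cases hx : (x : ℝ) ≤ 1 / 2 <;>
      simp only [halfStep, mem_preimage, hx, if_true, if_false, hp, hq,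
        leftHalf, mem_ofPred_eq]
  · refine Or.inr (Or.inr (Or.inl ?_))
    ext x
    by_cases hx : (x : ℝ) ≤ 1 / 2 <;>
      simp only [halfStep, mem_preimage, hx, if_true, if_false, hp, hq,
        leftHalf, mem_ofPred_eq, mem_compl_iff, not_true, not_false_eq_true]
  · refine Or.inl ?_
    ext x
    by_cases hx : (x : ℝ) ≤ 1 / 2 <;>
      simp only [halfStep, mem_preimage, hx, if_true, if_false, hp, hq, mem_empty_iff_false]

theorem volume_halfStep_preimage_inter (p q : ℝ) (A : Set ℝ) (S : Set I) :
    volume (halfStep p q ⁻¹' A ∩ doubling ⁻¹' S) =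
      volume (halfStep p q ⁻¹' A) * volume S := by
  rcases halfStep_preimage p q A with h | h | h | h <;> rw [h]
  · simp
  · rw [volume_leftHalf_inter_preimage, volume_leftHalf]
  · rw [volume_leftHalf_compl_inter_preimage, volume_leftHalf_compl]
  · simp [volume_preimage_doubling]

/-- Invariance under `doubling^[m]` reduces the claim to the first digit, which is independent of
everything determined after one step. Pairwise independence is all that `strong_law_ae_real`
requires. -/
theorem indepFun_halfStep_comp_iterate (p q : ℝ) {m n : ℕ} (h : m < n) :
    IndepFun (fun x => halfStep p q (doubling^[m] x)) (fun x => halfStep p q (doubling^[n] x))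
      (volume : Measure I) := by
  obtain ⟨k, rfl⟩ := Nat.exists_eq_add_of_lt h
  rw [indepFun_iff_measure_inter_preimage_eq_mul]
  intro s t hs ht
  have hm := measurePreserving_doubling.iterate m
  have hk := measurePreserving_doubling.iterate k
  have hS := measurable_halfStep p q hs
  have hT := measurable_halfStep p q ht
  have e1 : (fun x => halfStep p q (doubling^[m] x)) ⁻¹' s =
      doubling^[m] ⁻¹' (halfStep p q ⁻¹' s) := rfl
  have e2 : (fun x => halfStep p q (doubling^[m + k + 1] x)) ⁻¹' t =
      doubling^[m] ⁻¹' (doubling ⁻¹' (doubling^[k] ⁻¹' (halfStep p q ⁻¹' t))) := by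
    ext x
    change halfStep p q (doubling^[m + k + 1] x) ∈ t ↔
      halfStep p q (doubling^[k + 1] (doubling^[m] x)) ∈ t
    rw [← Function.iterate_add_apply, show m + k + 1 = k + 1 + m by omega]
  have hkT := hk.measurable hT
  have hdkT := measurable_doubling hkT
  rw [e1, e2, ← preimage_inter, hm.measure_preimage (hS.inter hdkT).nullMeasurableSet,
    hm.measure_preimage hS.nullMeasurableSet, hm.measure_preimage hdkT.nullMeasurableSet,
    volume_preimage_doubling, volume_halfStep_preimage_inter]

theorem integral_halfStep (p q : ℝ) : ∫ x, halfStep p q x = (p + q) / 2 := by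
  have e : halfStep p q = leftHalf.indicator (fun _ => p) + leftHalfᶜ.indicator (fun _ => q) := by
    funext x
    by_cases hx : (x : ℝ) ≤ 1 / 2
    · have h1 : x ∈ leftHalf := hx
      simp only [halfStep, hx, Pi.add_apply, indicator, h1, mem_compl_iff]
      simp
    · have h1 : x ∉ leftHalf := hx
      simp only [halfStep, hx, Pi.add_apply, indicator, h1, mem_compl_iff]
      simp
  rw [e, integral_add' ((integrable_const p).indicator measurableSet_leftHalf)
    ((integrable_const q).indicator measurableSet_leftHalf.compl),
    integral_indicator measurableSet_leftHalf, integral_indicator measurableSet_leftHalf.compl]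
  simp [Measure.real, volume_leftHalf, volume_leftHalf_compl]
  ring

/-- The strong law of large numbers for the binary digits of a Lebesgue-random point. -/
theorem ae_tendsto_average_halfStep (p q : ℝ) :
    ∀ᵐ x : I, Tendsto (fun n : ℕ => (∑ k ∈ Finset.range n, halfStep p q (doubling^[k] x)) / n)
      atTop (𝓝 ((p + q) / 2)) := by
  have h := strong_law_ae_real (μ := (volume : Measure I))
    (fun n x => halfStep p q (doubling^[n] x)) ?_ ?_ ?_
  · simpa only [Function.iterate_zero, id, integral_halfStep] using h
  · refine Integrable.of_bound (measurable_halfStep p q).aestronglyMeasurable (max |p| |q|)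
      (Eventually.of_forall fun x => ?_)
    change |if (x : ℝ) ≤ 1 / 2 then p else q| ≤ max |p| |q|
    split_ifs
    · exact le_max_left _ _
    · exact le_max_right _ _
  · intro m n hmn
    rcases lt_or_gt_of_ne hmn with h | h
    · exact indepFun_halfStep_comp_iterate p q h
    · exact (indepFun_halfStep_comp_iterate p q h).symm
  · intro n
    have hn := measurePreserving_doubling.iterate n
    refine ⟨((measurable_halfStep p q).comp hn.measurable).aemeasurable,
      (measurable_halfStep p q).aemeasurable, ?_⟩
    have : (fun x => halfStep p q (doubling^[n] x)) = halfStep p q ∘ doubling^[n] := rfl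
    rw [this, ← Measure.map_map (measurable_halfStep p q) hn.measurable, hn.map_eq]
    rfl

/-! ### Cylinders and density of almost every base orbit. -/

/-- Around every point there is a cylinder of rank `m` of the doubling map; such a cylinder is
independent of everything that happens after time `m`. -/
theorem exists_cylinder (m : ℕ) (x₀ : I) :
    ∃ C : Set I, MeasurableSet C ∧ (∀ x ∈ C, dist x x₀ ≤ (1 / 2) ^ m) ∧
      ∀ S : Set I, volume (C ∩ doubling^[m] ⁻¹' S) = 2⁻¹ ^ m * volume S := by
  induction m generalizing x₀ with
  | zero =>
    refine ⟨univ, .univ, fun x _ => ?_, fun S => by simp⟩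
    rw [Subtype.dist_eq, Real.dist_eq, abs_le]
    constructor <;> linarith [x.2.1, x.2.2, x₀.2.1, x₀.2.2, pow_zero (1 / 2 : ℝ)]
  | succ m ih =>
    -- The new cylinder is the preimage of `C` within the half containing `x₀`. Distances inside one
    -- half are exactly doubled, so the radius halves.
    obtain ⟨C, hC, hd, hv⟩ := ih (doubling x₀)
    have key : ∀ H : Set I, (∀ S, volume (H ∩ doubling ⁻¹' S) = 2⁻¹ * volume S) →
        ∀ S, volume ((H ∩ doubling ⁻¹' C) ∩ doubling^[m + 1] ⁻¹' S) =
          2⁻¹ ^ (m + 1) * volume S := by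
      intro H hH S
      rw [Function.iterate_succ, preimage_comp, inter_assoc, ← preimage_inter, hH, hv, pow_succ,
        ← mul_assoc, mul_comm (2⁻¹ : ENNReal)]
    have hpow : (1 / 2 : ℝ) ^ (m + 1) = 1 / 2 * (1 / 2) ^ m := pow_succ' _ _
    by_cases hx₀ : (x₀ : ℝ) ≤ 1 / 2
    · refine ⟨leftHalf ∩ doubling ⁻¹' C, measurableSet_leftHalf.inter (measurable_doubling hC),
        ?_, key _ volume_leftHalf_inter_preimage⟩
      rintro x ⟨hx, hxC⟩
      have := hd _ hxC
      rw [Subtype.dist_eq, Real.dist_eq] at this ⊢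
      rw [doubling_coe_of_le hx₀, doubling_coe_of_le hx, ← mul_sub, abs_mul] at this
      rw [abs_of_pos (by norm_num : (0 : ℝ) < 2)] at this
      linarith
    · refine ⟨leftHalfᶜ ∩ doubling ⁻¹' C,
        measurableSet_leftHalf.compl.inter (measurable_doubling hC),
        ?_, key _ volume_leftHalf_compl_inter_preimage⟩
      rintro x ⟨hx, hxC⟩
      have := hd _ hxC
      rw [Subtype.dist_eq, Real.dist_eq] at this ⊢
      rw [doubling_coe_of_gt hx₀, doubling_coe_of_gt hx, sub_sub_sub_cancel_right, ← mul_sub,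
        abs_mul] at this
      rw [abs_of_pos (by norm_num : (0 : ℝ) < 2)] at this
      linarith

instance : (volume : Measure I).IsOpenPosMeasure where
  open_pos U hU := by
    rintro ⟨x, hx⟩
    obtain ⟨ε, hε, hεU⟩ := Metric.isOpen_iff.1 hU x hx
    obtain ⟨m, hm⟩ := exists_pow_lt_of_lt_one hε (by norm_num : (1 / 2 : ℝ) < 1)
    obtain ⟨C, -, hd, hv⟩ := exists_cylinder m x
    have hC : volume C = 2⁻¹ ^ m := by simpa using hv univ
    have hpos : volume C ≠ 0 := by rw [hC]; simp
    exact fun h => hpos (measure_mono_null (fun y hy => hεU ((hd y hy).trans_lt hm)) h)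

/-- Almost every orbit of the doubling map comes within `2⁻ᵐ` of a given point. -/
theorem ae_exists_iterate_dist_le (m : ℕ) (x₀ : I) :
    ∀ᵐ x : I, ∃ n, dist (doubling^[n] x) x₀ ≤ (1 / 2) ^ m := by
  obtain ⟨C, hC, hd, hv⟩ := exists_cylinder m x₀
  have hmp := measurePreserving_doubling.iterate m
  have hCv : volume C = 2⁻¹ ^ m := by simpa using hv univ
  -- Orbits that avoid `C` at the times `0, m, …, (n-1)m`. These times look at disjoint blocks of
  -- digits, so the measure is `(1 - 2⁻ᵐ)ⁿ`.
  let E : ℕ → Set I := fun n => ⋂ j < n, (doubling^[m * j]) ⁻¹' Cᶜ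
  have hE : ∀ n, MeasurableSet (E n) := fun n =>
    MeasurableSet.iInter fun j => MeasurableSet.iInter fun _ =>
      (measurePreserving_doubling.iterate _).measurable hC.compl
  have hEs : ∀ n, E (n + 1) = doubling^[m] ⁻¹' E n \ (C ∩ doubling^[m] ⁻¹' E n) := by
    intro n
    ext x
    simp only [E, mem_iInter, mem_preimage, Set.mem_sdiff, mem_inter_iff, mem_compl_iff]
    have hj : ∀ j, doubling^[m * (j + 1)] x = doubling^[m * j] (doubling^[m] x) := fun j => by
      rw [← Function.iterate_add_apply, mul_add, mul_one]
    constructor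
    · intro h
      refine ⟨fun j hj' => hj j ▸ h (j + 1) (by omega), fun h' =>
        h 0 (by omega) (by simpa using h'.1)⟩
    · rintro ⟨h1, h2⟩ j hj'
      rcases j with _ | j
      · exact fun hx => h2 ⟨by simpa using hx, h1⟩
      · rw [hj]; exact h1 j (by omega)
  have hEv : ∀ n, volume (E n) = (1 - 2⁻¹ ^ m) ^ n := by
    intro n
    induction n with
    | zero => simp [E]
    | succ n ih =>
      have hfin : volume (C ∩ doubling^[m] ⁻¹' E n) ≠ ⊤ := measure_ne_top _ _
      rw [hEs, measure_sdiff inter_subset_right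
        (hC.inter (hmp.measurable (hE n))).nullMeasurableSet hfin,
        hmp.measure_preimage (hE n).nullMeasurableSet, hv, ih, pow_succ', ENNReal.sub_mul, one_mul]
      exact fun _ _ => ENNReal.pow_ne_top (by simp)
  have hlim : Tendsto (fun n : ℕ => (1 - (2⁻¹ : ENNReal) ^ m) ^ n) atTop (𝓝 0) := by
    apply ENNReal.tendsto_pow_atTop_nhds_zero_of_lt_one
    exact ENNReal.sub_lt_self (by simp) (by simp) (by simp)
  rw [ae_iff]
  refine le_antisymm (ge_of_tendsto' hlim fun n => ?_) (by simp)
  rw [← hEv]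
  refine measure_mono fun x hx => ?_
  simp only [E, mem_iInter, mem_preimage, mem_compl_iff]
  intro j _ hxj
  exact hx ⟨_, hd _ hxj⟩

/-- Almost every orbit of the doubling map accumulates at every point. -/
theorem ae_forall_mapClusterPt :
    ∀ᵐ x : I, ∀ z : I, MapClusterPt z atTop fun n : ℕ => doubling^[n] x := by
  obtain ⟨D, hDc, hDd⟩ := TopologicalSpace.exists_countable_dense I
  -- Restarting the orbit at every time `N` turns a single visit into infinitely many.
  have h : ∀ᵐ x : I, ∀ N m : ℕ, ∀ d ∈ D,
      ∃ n, dist (doubling^[n] (doubling^[N] x)) d ≤ (1 / 2) ^ m := by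
    rw [ae_all_iff]; intro N
    rw [ae_all_iff]; intro m
    rw [ae_ball_iff hDc]; intro d _
    exact (measurePreserving_doubling.iterate N).quasiMeasurePreserving.ae
      (ae_exists_iterate_dist_le m d)
  filter_upwards [h] with x hx z
  rw [mapClusterPt_iff_frequently]
  intro s hs
  obtain ⟨ε, hε, hεs⟩ := Metric.mem_nhds_iff.1 hs
  obtain ⟨d, hdD, hd⟩ := hDd.exists_dist_lt z (half_pos hε)
  obtain ⟨m, hm⟩ := exists_pow_lt_of_lt_one (half_pos hε) (by norm_num : (1 / 2 : ℝ) < 1)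
  rw [frequently_atTop]
  intro N
  obtain ⟨n, hn⟩ := hx N m d hdD
  refine ⟨n + N, Nat.le_add_left _ _, hεs ?_⟩
  rw [Metric.mem_ball, Function.iterate_add_apply]
  have := dist_triangle (doubling^[n] (doubling^[N] x)) d z
  rw [dist_comm d z] at this
  linarith

/-- The points whose first `N` iterates stay in the right half have positive measure. -/
theorem volume_iterate_gt_half_pos (N : ℕ) :
    0 < volume {x : I | ∀ k < N, ¬ ((doubling^[k] x : I) : ℝ) ≤ 1 / 2} := by
  induction N with
  | zero => simp
  | succ N ih =>
    have : {x : I | ∀ k < N + 1, ¬ ((doubling^[k] x : I) : ℝ) ≤ 1 / 2} =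
        leftHalfᶜ ∩ doubling ⁻¹' {x : I | ∀ k < N, ¬ ((doubling^[k] x : I) : ℝ) ≤ 1 / 2} := by
      ext x
      constructor
      · exact fun h => ⟨h 0 (by omega), fun k hk => h (k + 1) (by omega)⟩
      · rintro ⟨h0, h⟩ k hk
        rcases k with _ | k
        · exact h0
        · exact h k (by omega)
    rw [this, volume_leftHalf_compl_inter_preimage]
    exact ENNReal.mul_pos (by simp) ih.ne'

/-! ### Growth of the distance to an invariant segment. -/

/-- `j` is a fixed point of `g` near which `g` multiplies distances to `j` by `exp p`,
asymptotically. -/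
structure HasLogMultiplier (g : I → I) (j : I) (p : ℝ) : Prop where
  fix : g j = j
  bounds : ∀ ε > 0, ∃ δ > 0, ∀ y, dist y j < δ →
    Real.exp (p - ε) * dist y j ≤ dist (g y) j ∧ dist (g y) j ≤ Real.exp (p + ε) * dist y j

section Skew

variable {g₁ g₂ : I → I} {j : I} {p q : ℝ}

theorem skewProduct_iterate_fst (n : ℕ) (z : I × I) :
    ((skewProduct g₁ g₂)^[n] z).1 = doubling^[n] z.1 := by
  induction n with
  | zero => rfl
  | succ n ih => rw [Function.iterate_succ_apply', Function.iterate_succ_apply', ← ih]; rfl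

theorem skewProduct_snd_of_le {z : I × I} (h : (z.1 : ℝ) ≤ 1 / 2) :
    (skewProduct g₁ g₂ z).2 = g₁ z.2 := if_pos h

theorem skewProduct_snd_of_gt {z : I × I} (h : ¬ (z.1 : ℝ) ≤ 1 / 2) :
    (skewProduct g₁ g₂ z).2 = g₂ z.2 := if_neg h

theorem mem_segmentAt {z : I × I} : z ∈ segmentAt j ↔ z.2 = j := by
  simp [segmentAt]

theorem skewProduct_snd_fixed (h₁ : g₁ j = j) (h₂ : g₂ j = j) {z : I × I} (hz : z.2 = j) :
    (skewProduct g₁ g₂ z).2 = j := by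
  by_cases h : (z.1 : ℝ) ≤ 1 / 2
  · rw [skewProduct_snd_of_le h, hz, h₁]
  · rw [skewProduct_snd_of_gt h, hz, h₂]

theorem skewProduct_iterate_snd_fixed (h₁ : g₁ j = j) (h₂ : g₂ j = j) (x : I) (n : ℕ) :
    ((skewProduct g₁ g₂)^[n] (x, j)).2 = j := by
  induction n with
  | zero => rfl
  | succ n ih => rw [Function.iterate_succ_apply']; exact skewProduct_snd_fixed h₁ h₂ ih

theorem isCompactInvariant_segmentAt (h₁ : g₁ j = j) (h₂ : g₂ j = j) :
    IsCompactInvariant (skewProduct g₁ g₂) (segmentAt j) := by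
  refine ⟨isCompact_univ.prod isCompact_singleton, Subset.antisymm ?_ ?_⟩
  · rintro _ ⟨z, hz, rfl⟩
    exact mem_segmentAt.2 (skewProduct_snd_fixed h₁ h₂ (mem_segmentAt.1 hz))
  · rintro ⟨x, y⟩ hz
    obtain rfl : y = j := mem_segmentAt.1 hz
    obtain ⟨x', rfl⟩ := surjective_doubling x
    exact ⟨(x', y), mem_segmentAt.2 rfl, Prod.ext rfl (skewProduct_snd_fixed h₁ h₂ rfl)⟩

/-- A point is in the basin of a horizontal segment iff its height converges to that of the
segment. -/
theorem mem_basin_segmentAt_iff {F : I × I → I × I} {z : I × I} :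
    z ∈ basin F (segmentAt j) ↔ Tendsto (fun n : ℕ => (F^[n] z).2) atTop (𝓝 j) := by
  constructor
  · intro h
    rw [tendsto_nhds]
    intro V hV hj
    have h' : omegaLimit atTop (fun n : ℕ => F^[n]) {z} ⊆ Prod.snd ⁻¹' V := by
      intro w hw
      have : w.2 = j := mem_segmentAt.1 (h hw)
      simpa [this] using hj
    filter_upwards [eventually_mapsTo_of_isOpen_of_omegaLimit_subset atTop _ _
      (hV.preimage continuous_snd) h'] with n hn
    exact hn (mem_singleton z)
  · intro h w hw
    have hw' : MapClusterPt w atTop fun n : ℕ => F^[n] z :=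
      (mem_omegaLimit_singleton_iff_mapClusterPt _ _ _ _).1 hw
    have h2 : MapClusterPt w.2 atTop fun n : ℕ => (F^[n] z).2 :=
      hw'.continuousAt_comp continuous_snd.continuousAt
    have h3 : (𝓝 w.2 ⊓ 𝓝 j).NeBot := h2.clusterPt.neBot.mono (inf_le_inf_left _ h)
    exact mem_segmentAt.2 (eq_of_nhds_neBot h3)

/-- If the base orbit is dense and the heights converge to `j`, then the `ω`-limit set is
the whole segment at height `j`. -/
theorem segmentAt_subset_omegaSet {z : I × I}
    (hx : ∀ w : I, MapClusterPt w atTop fun n : ℕ => doubling^[n] z.1)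
    (hy : Tendsto (fun n : ℕ => ((skewProduct g₁ g₂)^[n] z).2) atTop (𝓝 j)) :
    segmentAt j ⊆ omegaSet (skewProduct g₁ g₂) z := by
  rintro ⟨w, y⟩ hw
  obtain rfl : y = j := mem_segmentAt.1 hw
  refine (mem_omegaLimit_singleton_iff_mapClusterPt _ _ _ _).2 ?_
  rw [mapClusterPt_iff_frequently]
  intro s hs
  obtain ⟨u, hu, v, hv, huv⟩ := mem_nhds_prod_iff.1 hs
  refine ((mapClusterPt_iff_frequently.1 (hx w) u hu).and_eventually (hy hv)).mono ?_
  rintro n ⟨h1, h2⟩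
  exact huv ⟨by rw [skewProduct_iterate_fst]; exact h1, h2⟩

theorem isTransitiveSet_segmentAt (h₁ : g₁ j = j) (h₂ : g₂ j = j) :
    IsTransitiveSet (skewProduct g₁ g₂) (segmentAt j) := by
  obtain ⟨x, hx⟩ := ae_forall_mapClusterPt.exists
  have hy : Tendsto (fun n : ℕ => ((skewProduct g₁ g₂)^[n] (x, j)).2) atTop (𝓝 j) := by
    simp only [skewProduct_iterate_snd_fixed h₁ h₂]
    exact tendsto_const_nhds
  exact ⟨(x, j), mem_segmentAt.2 rfl,
    Subset.antisymm (mem_basin_segmentAt_iff.2 hy) (segmentAt_subset_omegaSet hx hy)⟩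

theorem HasLogMultiplier.skewProduct_bounds (h₁ : HasLogMultiplier g₁ j p)
    (h₂ : HasLogMultiplier g₂ j q) {ε : ℝ} (hε : 0 < ε) :
    ∃ δ > 0, ∀ z : I × I, dist z.2 j < δ →
      Real.exp (halfStep p q z.1 - ε) * dist z.2 j ≤ dist (skewProduct g₁ g₂ z).2 j ∧
      dist (skewProduct g₁ g₂ z).2 j ≤ Real.exp (halfStep p q z.1 + ε) * dist z.2 j := by
  obtain ⟨δ₁, hδ₁, H₁⟩ := h₁.bounds ε hε
  obtain ⟨δ₂, hδ₂, H₂⟩ := h₂.bounds ε hε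
  refine ⟨min δ₁ δ₂, lt_min hδ₁ hδ₂, fun z hz => ?_⟩
  by_cases h : (z.1 : ℝ) ≤ 1 / 2
  · rw [skewProduct_snd_of_le h, halfStep, if_pos h]
    exact H₁ _ (hz.trans_le (min_le_left _ _))
  · rw [skewProduct_snd_of_gt h, halfStep, if_neg h]
    exact H₂ _ (hz.trans_le (min_le_right _ _))

/-- If the averages of a sequence converge to `l`, then the averages of the sequence shifted by
`c` converge to `l + c`. -/
theorem tendsto_sum_add_const_div {a : ℕ → ℝ} {l : ℝ}
    (h : Tendsto (fun n : ℕ => (∑ k ∈ Finset.range n, a k) / n) atTop (𝓝 l)) (c : ℝ) :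
    Tendsto (fun n : ℕ => (∑ k ∈ Finset.range n, (a k + c)) / n) atTop (𝓝 (l + c)) := by
  refine (h.add_const c).congr' ?_
  filter_upwards [eventually_gt_atTop 0] with n hn
  have : (n : ℝ) ≠ 0 := by positivity
  rw [Finset.sum_add_distrib, Finset.sum_const, Finset.card_range, nsmul_eq_mul]
  field_simp

theorem tendsto_sum_atTop_of_average {a : ℕ → ℝ} {l : ℝ} (hl : 0 < l)
    (h : Tendsto (fun n : ℕ => (∑ k ∈ Finset.range n, a k) / n) atTop (𝓝 l)) :
    Tendsto (fun n : ℕ => ∑ k ∈ Finset.range n, a k) atTop atTop := by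
  refine (h.pos_mul_atTop hl tendsto_natCast_atTop_atTop).congr' ?_
  filter_upwards [eventually_gt_atTop 0] with n hn
  have : (n : ℝ) ≠ 0 := by positivity
  field_simp

theorem tendsto_sum_atBot_of_average {a : ℕ → ℝ} {l : ℝ} (hl : l < 0)
    (h : Tendsto (fun n : ℕ => (∑ k ∈ Finset.range n, a k) / n) atTop (𝓝 l)) :
    Tendsto (fun n : ℕ => ∑ k ∈ Finset.range n, a k) atTop atBot := by
  refine (h.neg_mul_atTop hl tendsto_natCast_atTop_atTop).congr' ?_
  filter_upwards [eventually_gt_atTop 0] with n hn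
  have : (n : ℝ) ≠ 0 := by positivity
  field_simp

/-- Over a base point whose digits obey the law of large numbers, a negative normal Lyapunov
exponent forces a whole fibre neighbourhood of the segment into its basin. -/
theorem exists_fiber_ball_subset_basin (h₁ : HasLogMultiplier g₁ j p)
    (h₂ : HasLogMultiplier g₂ j q) (hpq : p + q < 0) {x : I}
    (hx : Tendsto (fun n : ℕ => (∑ k ∈ Finset.range n, halfStep p q (doubling^[k] x)) / n)
      atTop (𝓝 ((p + q) / 2))) :
    ∃ ρ > 0, ∀ y, dist y j < ρ → (x, y) ∈ basin (skewProduct g₁ g₂) (segmentAt j) := by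
  -- The digit averages tend to `(p + q) / 2`. An error of half its absolute value per step still
  -- leaves the negative drift `(p + q) / 4`.
  obtain ⟨δ, hδ, H⟩ := h₁.skewProduct_bounds h₂ (ε := -(p + q) / 4) (by linarith)
  have hT := tendsto_sum_atBot_of_average (by linarith)
    (tendsto_sum_add_const_div hx (-(p + q) / 4))
  set T : ℕ → ℝ := fun n =>
    ∑ k ∈ Finset.range n, (halfStep p q (doubling^[k] x) + -(p + q) / 4) with hTdef
  obtain ⟨B, hB⟩ : ∃ B, ∀ n, T n ≤ B := by
    obtain ⟨B, hB⟩ := Filter.bddAbove_range_of_tendsto_atTop_atBot hT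
    exact ⟨B, fun n => hB (mem_range_self n)⟩
  -- `exp B` bounds all accumulated growth factors, so orbits starting this close never leave the
  -- `δ`-strip where the one-step bounds hold.
  refine ⟨δ * Real.exp (-B), by positivity, fun y hy => ?_⟩
  have hdist : ∀ n, dist ((skewProduct g₁ g₂)^[n] (x, y)).2 j ≤ Real.exp (T n) * dist y j := by
    intro n
    induction n with
    | zero => simp [hTdef]
    | succ n ih =>
      have hlt : dist ((skewProduct g₁ g₂)^[n] (x, y)).2 j < δ := by
        refine ih.trans_lt ?_
        calc Real.exp (T n) * dist y j ≤ Real.exp B * dist y j := by gcongr; exact hB n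
          _ < Real.exp B * (δ * Real.exp (-B)) := by gcongr
          _ = δ := by rw [mul_left_comm, ← Real.exp_add]; simp
      rw [Function.iterate_succ_apply']
      refine (H _ hlt).2.trans ?_
      rw [skewProduct_iterate_fst]
      have : T (n + 1) = halfStep p q (doubling^[n] x) + -(p + q) / 4 + T n := by
        simp only [hTdef, Finset.sum_range_succ]; ring
      rw [this, Real.exp_add _ (T n), mul_assoc]
      gcongr
  rw [mem_basin_segmentAt_iff, tendsto_iff_dist_tendsto_zero]
  refine squeeze_zero (fun _ => dist_nonneg) hdist ?_
  simpa using (Real.tendsto_exp_atBot.comp hT).mul_const (dist y j)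

/-- Over a base point whose digits obey the law of large numbers, a positive normal Lyapunov
exponent keeps every orbit off the segment from converging to it. -/
theorem notMem_basin_of_pos (h₁ : HasLogMultiplier g₁ j p) (h₂ : HasLogMultiplier g₂ j q)
    (inj₁ : Function.Injective g₁) (inj₂ : Function.Injective g₂) (hpq : 0 < p + q) {x : I}
    (hx : Tendsto (fun n : ℕ => (∑ k ∈ Finset.range n, halfStep p q (doubling^[k] x)) / n)
      atTop (𝓝 ((p + q) / 2))) {y : I} (hy : y ≠ j) :
    (x, y) ∉ basin (skewProduct g₁ g₂) (segmentAt j) := by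
  intro hmem
  rw [mem_basin_segmentAt_iff] at hmem
  obtain ⟨δ, hδ, H⟩ := h₁.skewProduct_bounds h₂ (ε := (p + q) / 4) (by linarith)
  have hT := tendsto_sum_atTop_of_average (by linarith)
    (tendsto_sum_add_const_div hx (-((p + q) / 4)))
  set T : ℕ → ℝ := fun n =>
    ∑ k ∈ Finset.range n, (halfStep p q (doubling^[k] x) + -((p + q) / 4)) with hTdef
  set F := skewProduct g₁ g₂ with hF
  -- Injectivity prevents landing on the segment in finite time, so the distance at time `N` is
  -- positive and the later expansion contradicts convergence.
  have hne : ∀ n, (F^[n] (x, y)).2 ≠ j := by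
    intro n
    induction n with
    | zero => exact hy
    | succ n ih =>
      rw [Function.iterate_succ_apply']
      by_cases h : ((F^[n] (x, y)).1 : ℝ) ≤ 1 / 2
      · rw [hF, skewProduct_snd_of_le h]
        exact fun h' => ih (inj₁ (h'.trans h₁.fix.symm))
      · rw [hF, skewProduct_snd_of_gt h]
        exact fun h' => ih (inj₂ (h'.trans h₂.fix.symm))
  obtain ⟨N, hN⟩ := eventually_atTop.1 (hmem (Metric.ball_mem_nhds j hδ))
  have hlow : ∀ n, N ≤ n → Real.exp (T n - T N) * dist (F^[N] (x, y)).2 j ≤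
      dist (F^[n] (x, y)).2 j := by
    intro n hn
    induction n, hn using Nat.le_induction with
    | base => simp
    | succ n hn ih =>
      rw [Function.iterate_succ_apply']
      refine le_trans ?_ (H _ (hN n hn)).1
      rw [hF, skewProduct_iterate_fst]
      have : T (n + 1) - T N = (halfStep p q (doubling^[n] x) - (p + q) / 4) + (T n - T N) := by
        simp only [hTdef, Finset.sum_range_succ]; ring
      rw [this, Real.exp_add, mul_assoc]
      gcongr
  have hpos : 0 < dist (F^[N] (x, y)).2 j := dist_pos.2 (hne N)
  have hinf : Tendsto (fun n => Real.exp (T n - T N) * dist (F^[N] (x, y)).2 j) atTop atTop :=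
    (Real.tendsto_exp_atTop.comp (tendsto_atTop_add_const_right _ _ hT)).atTop_mul_const hpos
  have hdist := (tendsto_iff_dist_tendsto_zero.1 hmem)
  exact not_tendsto_nhds_of_tendsto_atTop
    (tendsto_atTop_mono' _ (eventually_atTop.2 ⟨N, hlow⟩) hinf) _ hdist

/-! ### Attractors and chaotic saddles. -/

/-- The base points over which the fibre ball of radius `δ` lies in the basin. -/
def uniformBase (F : I × I → I × I) (j : I) (δ : ℝ) : Set I :=
  {x | ∀ y, dist y j < δ → (x, y) ∈ basin F (segmentAt j)}

/-- Almost every fibre has a basin radius, but it depends on the base point. Continuity of the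
measure along the radii `1/(n+1)` makes one radius work on a base set of measure close to `1`. -/
theorem exists_lt_volume_uniformBase (h₁ : HasLogMultiplier g₁ j p)
    (h₂ : HasLogMultiplier g₂ j q) (hpq : p + q < 0) {a : ENNReal} (ha : a < 1) :
    ∃ δ > 0, a < volume (uniformBase (skewProduct g₁ g₂) j δ) := by
  set F := skewProduct g₁ g₂
  have hmono : Monotone fun n : ℕ => uniformBase F j (1 / ((n : ℝ) + 1)) := fun m n hmn x hx y hy =>
    hx y (hy.trans_le (Nat.one_div_le_one_div hmn))
  have hfull : volume (⋃ n : ℕ, uniformBase F j (1 / ((n : ℝ) + 1))) = 1 := by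
    rw [← measure_univ (μ := (volume : Measure I))]
    refine measure_congr ?_
    filter_upwards [ae_tendsto_average_halfStep p q] with x hx
    obtain ⟨ρ, hρ, H⟩ := exists_fiber_ball_subset_basin h₁ h₂ hpq hx
    obtain ⟨n, hn⟩ := exists_nat_one_div_lt hρ
    exact propext ⟨fun _ => trivial,
      fun _ => mem_iUnion.2 ⟨n, fun y hy => H y (hy.trans hn)⟩⟩
  rw [hmono.measure_iUnion] at hfull
  rw [← hfull] at ha
  obtain ⟨n, hn⟩ := lt_iSup_iff.1 ha
  exact ⟨_, Nat.one_div_pos_of_nat, hn⟩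

theorem thickening_segmentAt (δ : ℝ) :
    Metric.thickening δ (segmentAt j) = univ ×ˢ Metric.ball j δ := by
  ext ⟨x, y⟩
  rw [Metric.mem_thickening_iff]
  constructor
  · rintro ⟨w, hw, hd⟩
    rw [Prod.dist_eq, max_lt_iff, mem_segmentAt.1 hw] at hd
    exact ⟨mem_univ _, hd.2⟩
  · rintro ⟨-, hy⟩
    have hδ : 0 < δ := dist_nonneg.trans_lt hy
    exact ⟨(x, j), mem_segmentAt.2 rfl, by simpa [Prod.dist_eq, hδ] using hy⟩

/-- The `δ`-neighbourhood is a product strip. For small `δ`, the basin fills the strip over a base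
set of measure above `a`, which bounds the ratio below. -/
theorem isEssentialAttractor_segmentAt (h₁ : HasLogMultiplier g₁ j p)
    (h₂ : HasLogMultiplier g₂ j q) (hpq : p + q < 0) :
    IsEssentialAttractor (skewProduct g₁ g₂) (segmentAt j) := by
  refine ⟨isCompactInvariant_segmentAt h₁.fix h₂.fix, ?_⟩
  set F := skewProduct g₁ g₂
  have hle : ∀ s t : Set (I × I), volume (s ∩ t) / volume s ≤ 1 := fun s t =>
    ENNReal.div_le_of_le_mul (by rw [one_mul]; exact measure_mono inter_subset_left)
  rw [tendsto_order]
  refine ⟨fun a ha => ?_, fun a ha => Eventually.of_forall fun δ => (hle _ _).trans_lt ha⟩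
  obtain ⟨δ₀, hδ₀, hG⟩ := exists_lt_volume_uniformBase h₁ h₂ hpq ha
  filter_upwards [Ioo_mem_nhdsGT hδ₀] with δ hδ
  refine hG.trans_le ?_
  have hball : volume (Metric.ball j δ) ≠ 0 :=
    (Metric.measure_ball_pos volume j hδ.1).ne'
  rw [thickening_segmentAt, ENNReal.le_div_iff_mul_le (Or.inl ?_) (Or.inl (measure_ne_top _ _)),
    Measure.volume_eq_prod, Measure.prod_prod, measure_univ, one_mul, ← Measure.prod_prod]
  · refine measure_mono ?_
    rintro ⟨x, y⟩ ⟨hx, hy⟩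
    exact ⟨⟨mem_univ _, hy⟩, hx y (lt_trans hy hδ.2)⟩
  · rwa [Measure.volume_eq_prod, Measure.prod_prod, measure_univ, one_mul]

/-- Almost every basin point has a dense base orbit, so its `ω`-limit set contains the whole segment
and the point lies in no smaller basin. -/
theorem isMilnorAttractor_segmentAt (h₁ : HasLogMultiplier g₁ j p)
    (h₂ : HasLogMultiplier g₂ j q) (hpq : p + q < 0) :
    IsMilnorAttractor (skewProduct g₁ g₂) (segmentAt j) := by
  set F := skewProduct g₁ g₂
  have hpos : volume (basin F (segmentAt j)) ≠ 0 := by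
    obtain ⟨δ, hδ, hG⟩ := exists_lt_volume_uniformBase h₁ h₂ hpq zero_lt_one
    have hsub : uniformBase F j δ ×ˢ Metric.ball j δ ⊆ basin F (segmentAt j) := by
      rintro ⟨x, y⟩ ⟨hx, hy⟩
      exact hx y hy
    refine ((ENNReal.mul_pos hG.ne'
      (Metric.measure_ball_pos volume j hδ).ne').trans_le ?_).ne'
    rw [← Measure.prod_prod]
    exact measure_mono hsub
  refine ⟨isCompactInvariant_segmentAt h₁.fix h₂.fix, hpos, fun A' _ hA' heq => ?_⟩
  have hgen : ∀ᵐ z : I × I, ∀ w : I, MapClusterPt w atTop fun n : ℕ => doubling^[n] z.1 :=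
    Measure.quasiMeasurePreserving_fst.ae ae_forall_mapClusterPt
  have hfreq : ∃ᵐ z : I × I, z ∈ basin F (segmentAt j) :=
    frequently_ae_iff.2 hpos
  obtain ⟨z, hz, hzg, hzeq⟩ := (hfreq.and_eventually (hgen.and heq)).exists
  have hz' : z ∈ basin F A' := hzeq.symm.mp hz
  exact hA'.2 ((segmentAt_subset_omegaSet hzg (mem_basin_segmentAt_iff.1 hz)).trans hz')

theorem isChaoticSaddle_segmentAt (h₁ : HasLogMultiplier g₁ j p)
    (h₂ : HasLogMultiplier g₂ j q) (inj₁ : Function.Injective g₁) (inj₂ : Function.Injective g₂)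
    (hpq : 0 < p + q) : IsChaoticSaddle (skewProduct g₁ g₂) (segmentAt j) := by
  have htr := isTransitiveSet_segmentAt h₁.fix h₂.fix
  refine ⟨isCompactInvariant_segmentAt h₁.fix h₂.fix, htr, univ, univ_mem, ?_, ?_⟩
  · obtain ⟨z, -, hz⟩ := htr
    exact ⟨z, hz.subset, mem_univ _⟩
  · have hx : ∀ᵐ z : I × I, Tendsto (fun n : ℕ =>
        (∑ k ∈ Finset.range n, halfStep p q (doubling^[k] z.1)) / n) atTop (𝓝 ((p + q) / 2)) :=
      Measure.quasiMeasurePreserving_fst.ae (ae_tendsto_average_halfStep p q)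
    have hy : ∀ᵐ z : I × I, z.2 ≠ j :=
      Measure.quasiMeasurePreserving_snd.ae (compl_mem_ae_iff.2 (measure_singleton j))
    refine measure_eq_zero_iff_ae_notMem.2 ?_
    filter_upwards [hx, hy] with z hzx hzy
    exact notMem_basin_of_pos h₁ h₂ inj₁ inj₂ hpq hzx hzy

/-! ### Escape from a strip and local riddling. -/

theorem exists_forall_le_dist_of_injective {g : I → I} (hg : Continuous g)
    (inj : Function.Injective g) (hj : g j = j) {ρ : ℝ} (hρ : 0 < ρ) :
    ∃ ρ' > 0, ∀ y, ρ ≤ dist y j → ρ' ≤ dist (g y) j := by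
  have hK : IsCompact {y : I | ρ ≤ dist y j} :=
    (isClosed_le continuous_const (continuous_id.dist continuous_const)).isCompact
  obtain ⟨ρ', h, H⟩ := hK.exists_forall_le' (f := fun y => dist (g y) j) (a := 0)
    (hg.dist continuous_const).continuousOn (fun y hy => dist_pos.2 fun h => by
      rw [inj (h.trans hj.symm), mem_ofPred_eq, dist_self] at hy
      exact hρ.not_ge hy)
  exact ⟨ρ', h, H⟩

theorem exists_forall_le_dist_iterate (c₁ : Continuous g₁) (c₂ : Continuous g₂)
    (inj₁ : Function.Injective g₁) (inj₂ : Function.Injective g₂) (h₁ : g₁ j = j) (h₂ : g₂ j = j)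
    (m : ℕ) {ρ : ℝ} (hρ : 0 < ρ) :
    ∃ ρ' > 0, ∀ z : I × I, ρ ≤ dist z.2 j → ρ' ≤ dist ((skewProduct g₁ g₂)^[m] z).2 j := by
  induction m with
  | zero => exact ⟨ρ, hρ, fun z hz => hz⟩
  | succ m ih =>
    obtain ⟨ρ', hρ', H⟩ := ih
    obtain ⟨a, ha, Ha⟩ := exists_forall_le_dist_of_injective c₁ inj₁ h₁ hρ'
    obtain ⟨b, hb, Hb⟩ := exists_forall_le_dist_of_injective c₂ inj₂ h₂ hρ'
    refine ⟨min a b, lt_min ha hb, fun z hz => ?_⟩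
    rw [Function.iterate_succ_apply']
    by_cases h : (((skewProduct g₁ g₂)^[m] z).1 : ℝ) ≤ 1 / 2
    · rw [skewProduct_snd_of_le h]
      exact (min_le_left _ _).trans (Ha _ (H z hz))
    · rw [skewProduct_snd_of_gt h]
      exact (min_le_right _ _).trans (Hb _ (H z hz))

/-- If `g₂` pushes points near `j` away from `j`, then points off the segment leave the strip of
width `c` after sufficiently many consecutive visits of the base orbit to the right half. -/
theorem exists_escape_time (c₂ : Continuous g₂) {c : ℝ}
    (hrep : ∀ y, 0 < dist y j → dist y j ≤ c → dist y j < dist (g₂ y) j) {ρ : ℝ} (hρ : 0 < ρ) :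
    ∃ N : ℕ, ∀ z : I × I, ρ ≤ dist z.2 j → (∀ k < N, ¬ ((doubling^[k] z.1 : I) : ℝ) ≤ 1 / 2) →
      ∃ n, c < dist ((skewProduct g₁ g₂)^[n] z).2 j := by
  have hK : IsCompact {y : I | ρ ≤ dist y j ∧ dist y j ≤ c} :=
    ((isClosed_le continuous_const (continuous_id.dist continuous_const)).inter
      (isClosed_le (continuous_id.dist continuous_const) continuous_const)).isCompact
  -- By compactness, each application of `g₂` at distances between `ρ` and `c` gains at least `η`;
  -- more than `c / η` gains exceed `c`.
  obtain ⟨η, hη, H⟩ := hK.exists_forall_le' (f := fun y => dist (g₂ y) j - dist y j) (a := 0)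
    ((c₂.dist continuous_const).sub (continuous_id.dist continuous_const)).continuousOn
    (fun y hy => sub_pos.2 (hrep y (hρ.trans_le hy.1) hy.2))
  obtain ⟨N, hN⟩ := exists_nat_gt (c / η)
  refine ⟨N, fun z hz hd => ?_⟩
  by_contra! hcon
  have key : ∀ k ≤ N, ρ + k * η ≤ dist ((skewProduct g₁ g₂)^[k] z).2 j := by
    intro k hk
    induction k with
    | zero => simpa using hz
    | succ k ih =>
      have ih' := ih (by omega)
      have hkη : 0 ≤ (k : ℝ) * η := by positivity
      have := H _ ⟨by linarith, hcon k⟩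
      have hgt : ¬ (((skewProduct g₁ g₂)^[k] z).1 : ℝ) ≤ 1 / 2 := by
        rw [skewProduct_iterate_fst]; exact hd k hk
      rw [Function.iterate_succ_apply', skewProduct_snd_of_gt hgt]
      push_cast
      linarith
  have h1 := key N le_rfl
  have h2 := hcon N
  rw [div_lt_iff₀ hη] at hN
  linarith

/-- Closeness to `x₀` fixes only the first `m` digits. During these the height stays a definite
distance from `j`, by compactness and injectivity; a following block of `N` right-half digits then
forces an escape. The escaping points contain a product `X ×ˢ Y` of non-null sets. -/
theorem hasLocallyRiddledBasin_segmentAt (h₁ : HasLogMultiplier g₁ j p)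
    (h₂ : HasLogMultiplier g₂ j q) (hpq : p + q < 0) (c₁ : Continuous g₁) (c₂ : Continuous g₂)
    (inj₁ : Function.Injective g₁) (inj₂ : Function.Injective g₂) {c : ℝ} (hc : 0 < c)
    (hrep : ∀ y, 0 < dist y j → dist y j ≤ c → dist y j < dist (g₂ y) j) :
    HasLocallyRiddledBasin (skewProduct g₁ g₂) (segmentAt j) := by
  refine ⟨isMilnorAttractor_segmentAt h₁ h₂ hpq, Metric.thickening c (segmentAt j),
    (Metric.isOpen_thickening.mem_nhdsSet).2 (Metric.self_subset_thickening hc _), ?_⟩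
  rintro ⟨x₀, y₀⟩ hxy ε hε
  obtain rfl : y₀ = j := mem_segmentAt.1 hxy
  obtain ⟨y, hy, hyj⟩ : ∃ y, y ∈ Metric.ball y₀ ε \ {y₀} := by
    refine nonempty_of_measure_ne_zero (μ := volume) ?_
    rw [measure_sdiff_null (measure_singleton _)]
    exact (Metric.measure_ball_pos volume y₀ hε).ne'
  have hρ : 0 < dist y y₀ / 2 := half_pos (dist_pos.2 hyj)
  obtain ⟨m, hm⟩ := exists_pow_lt_of_lt_one hε (by norm_num : (1 / 2 : ℝ) < 1)
  obtain ⟨C, -, hCd, hCv⟩ := exists_cylinder m x₀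
  obtain ⟨ρ', hρ', H'⟩ := exists_forall_le_dist_iterate c₁ c₂ inj₁ inj₂ h₁.fix h₂.fix m hρ
  obtain ⟨N, hN⟩ := exists_escape_time (g₁ := g₁) c₂ hrep hρ'
  set X := C ∩ doubling^[m] ⁻¹' {x : I | ∀ k < N, ¬ ((doubling^[k] x : I) : ℝ) ≤ 1 / 2}
  set Y := {y' : I | dist y y₀ / 2 < dist y' y₀ ∧ dist y' y₀ < ε}
  have hX : volume X ≠ 0 := by
    rw [hCv]
    exact (ENNReal.mul_pos (by simp) (volume_iterate_gt_half_pos N).ne').ne'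
  have hY : volume Y ≠ 0 := by
    have hopen : IsOpen Y := (isOpen_lt continuous_const (continuous_id.dist continuous_const)).inter
      (isOpen_lt (continuous_id.dist continuous_const) continuous_const)
    exact (hopen.measure_pos volume ⟨y, by linarith, hy⟩).ne'
  refine (ENNReal.mul_pos hX hY).trans_le ?_
  rw [← Measure.prod_prod]
  refine measure_mono ?_
  rintro ⟨x, y'⟩ ⟨⟨hxC, hxN⟩, hy1, hy2⟩
  refine ⟨?_, ?_⟩
  · rw [Metric.mem_ball, Prod.dist_eq]
    exact max_lt ((hCd x hxC).trans_lt hm) hy2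
  · obtain ⟨n, hn⟩ := hN ((skewProduct g₁ g₂)^[m] (x, y')) (H' _ hy1.le) (by
      rw [skewProduct_iterate_fst]; exact hxN)
    rw [← Function.iterate_add_apply] at hn
    intro hmem
    have := mem_iInter.1 hmem (n + m)
    rw [thickening_segmentAt] at this
    exact lt_asymm hn this.2

end Skew

/-! ### The sign boundary of `u(b) + v(t)`. -/

section SignChange

variable {u v s : ℝ → ℝ} {J : Set ℝ}

theorem eventually_le_of_neg {r t : ℝ} (hu : ContinuousAt u r) (ht : t ∈ Ioo (0 : ℝ) 1)
    (hpos : ∀ b ∈ J, ∀ t ∈ Ioo (0 : ℝ) 1, s b < t → 0 < u b + v t) (h : u r + v t < 0) :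
    ∀ᶠ b in 𝓝[J] r, t ≤ s b := by
  have h1 : ∀ᶠ b in 𝓝 r, u b + v t < 0 :=
    (hu.add continuousAt_const).eventually_lt continuousAt_const h
  filter_upwards [nhdsWithin_le_nhds h1, self_mem_nhdsWithin] with b hb hbJ
  exact not_lt.1 fun hlt => lt_asymm hb (hpos b hbJ t ht hlt)

theorem eventually_ge_of_pos {r t : ℝ} (hu : ContinuousAt u r) (ht : t ∈ Ioo (0 : ℝ) 1)
    (hneg : ∀ b ∈ J, ∀ t ∈ Ioo (0 : ℝ) 1, t < s b → u b + v t < 0) (h : 0 < u r + v t) :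
    ∀ᶠ b in 𝓝[J] r, s b ≤ t := by
  have h1 : ∀ᶠ b in 𝓝 r, 0 < u b + v t :=
    continuousAt_const.eventually_lt (hu.add continuousAt_const) h
  filter_upwards [nhdsWithin_le_nhds h1, self_mem_nhdsWithin] with b hb hbJ
  exact not_lt.1 fun hlt => lt_asymm hb (hneg b hbJ t ht hlt)

/-- Test heights `t` just below and just above `s b` have strict signs. These persist for nearby
`b'`, trapping `s b'` between them. -/
theorem continuousOn_sign_boundary (hu : ContinuousOn u (Ioo 0 1)) (hJ : J ⊆ Ioo 0 1)
    (hs : MapsTo s J (Ioo 0 1))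
    (hneg : ∀ b ∈ J, ∀ t ∈ Ioo (0 : ℝ) 1, t < s b → u b + v t < 0)
    (hpos : ∀ b ∈ J, ∀ t ∈ Ioo (0 : ℝ) 1, s b < t → 0 < u b + v t) : ContinuousOn s J := by
  intro b hb
  have hub := hu.continuousAt (isOpen_Ioo.mem_nhds (hJ hb))
  have hsb := hs hb
  refine tendsto_order.2 ⟨fun a ha => ?_, fun a ha => ?_⟩
  · obtain ⟨t, ht1, ht2⟩ := exists_between (max_lt ha hsb.1)
    have ht : t ∈ Ioo (0 : ℝ) 1 := ⟨(le_max_right _ _).trans_lt ht1, ht2.trans hsb.2⟩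
    filter_upwards [eventually_le_of_neg hub ht hpos (hneg b hb t ht ht2)] with b' hb'
    exact (le_max_left _ _).trans_lt (ht1.trans_le hb')
  · obtain ⟨t, ht1, ht2⟩ := exists_between (lt_min ha hsb.2)
    have ht : t ∈ Ioo (0 : ℝ) 1 := ⟨hsb.1.trans ht1, ht2.trans_le (min_le_right _ _)⟩
    filter_upwards [eventually_ge_of_pos hub ht hneg (hpos b hb t ht ht1)] with b' hb'
    exact hb'.trans_lt (ht2.trans_le (min_le_left _ _))

theorem eq_zero_at_sign_boundary (hv : ContinuousOn v (Ioo 0 1)) {b c : ℝ} (hc : c ∈ Ioo (0 : ℝ) 1)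
    (hneg : ∀ t ∈ Ioo (0 : ℝ) 1, t < c → u b + v t < 0)
    (hpos : ∀ t ∈ Ioo (0 : ℝ) 1, c < t → 0 < u b + v t) : u b + v c = 0 := by
  have hvc : Tendsto (fun t => u b + v t) (𝓝 c) (𝓝 (u b + v c)) :=
    (hv.continuousAt (isOpen_Ioo.mem_nhds hc)).const_add _
  have hI : ∀ᶠ t in 𝓝 c, t ∈ Ioo (0 : ℝ) 1 := isOpen_Ioo.mem_nhds hc
  refine le_antisymm ?_ ?_
  · refine le_of_tendsto (hvc.mono_left (nhdsWithin_le_nhds (s := Iio c))) ?_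
    filter_upwards [nhdsWithin_le_nhds hI, self_mem_nhdsWithin] with t ht htc
    exact (hneg t ht htc).le
  · refine ge_of_tendsto (hvc.mono_left (nhdsWithin_le_nhds (s := Ioi c))) ?_
    filter_upwards [nhdsWithin_le_nhds hI, self_mem_nhdsWithin] with t ht htc
    exact (hpos t ht htc).le

/-- A continuous solution `s` of `u b + v (s b) = 0` is smooth where `v' ≠ 0`. -/
theorem contDiffAt_of_implicit {b : ℝ} (hu : ContDiffAt ℝ ∞ u b) (hv : ContDiffAt ℝ ∞ v (s b))
    (hs : ContinuousAt s b) (heq : ∀ᶠ b' in 𝓝 b, u b' + v (s b') = 0) (hd : deriv v (s b) ≠ 0) :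
    ContDiffAt ℝ ∞ s b := by
  have hd' : HasFDerivAt v
      (ContinuousLinearEquiv.unitsEquivAut ℝ (Units.mk0 _ hd) : ℝ →L[ℝ] ℝ) (s b) :=
    (hv.differentiableAt (by simp)).hasDerivAt.hasFDerivAt_equiv hd
  have hinv := hv.to_localInverse hd' (by simp)
  have hb0 : v (s b) = -u b := by linarith [heq.self_of_nhds]
  rw [hb0] at hinv
  refine (hinv.comp b hu.neg).congr_of_eventuallyEq ?_
  -- Continuity of `s` keeps `s b'` in the domain where `v` is inverted, so `s` agrees locally with
  -- that inverse composed with `-u`.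
  have hsrc := (hv.toOpenPartialHomeomorph v hd' (by simp)).open_source.mem_nhds
    (hv.mem_toOpenPartialHomeomorph_source hd' (by simp))
  filter_upwards [hs hsrc, heq] with b' hb' hbe
  have hb1 : -u b' = v (s b') := by linarith
  simp only [Function.comp_apply, hb1]
  exact ((hv.toOpenPartialHomeomorph v hd' (by simp)).left_inv hb').symm

/-- The limit `1` serves the end `r` of the first curve. The limit `0` serves the end `l` of the
second, to which the lemma is applied after negating `u` and `v`. -/
theorem exists_sign_boundary (hJo : IsOpen J) (hJ : J ⊆ Ioo 0 1)
    (hu : ContDiffOn ℝ ∞ u (Ioo 0 1)) (hv : ContDiffOn ℝ ∞ v (Ioo 0 1))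
    (h : ∀ b ∈ J, ChangesNegToPos fun t => u b + v t) :
    ∃ s : ℝ → ℝ, MapsTo s J (Ioo 0 1) ∧ ContinuousOn s J ∧
      (∀ b ∈ J, deriv v (s b) ≠ 0 → ContDiffAt ℝ ∞ s b) ∧
      (∀ r ∈ Ioo (0 : ℝ) 1, (∀ t ∈ Ioo (0 : ℝ) 1, u r + v t < 0) → Tendsto s (𝓝[J] r) (𝓝 1)) ∧
      (∀ r ∈ Ioo (0 : ℝ) 1, (∀ t ∈ Ioo (0 : ℝ) 1, 0 < u r + v t) → Tendsto s (𝓝[J] r) (𝓝 0)) ∧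
      (∀ b ∈ J, ∀ t ∈ Ioo (0 : ℝ) 1, t < s b → u b + v t < 0) ∧
      (∀ b ∈ J, ∀ t ∈ Ioo (0 : ℝ) 1, s b < t → 0 < u b + v t) := by
  choose! s hs hn hp using h
  have hneg : ∀ b ∈ J, ∀ t ∈ Ioo (0 : ℝ) 1, t < s b → u b + v t < 0 :=
    fun b hb t ht hlt => hn b hb t ⟨ht.1, hlt⟩
  have hpos : ∀ b ∈ J, ∀ t ∈ Ioo (0 : ℝ) 1, s b < t → 0 < u b + v t :=
    fun b hb t ht hlt => hp b hb t ⟨hlt, ht.2⟩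
  have hcont := continuousOn_sign_boundary hu.continuousOn hJ hs hneg hpos
  refine ⟨s, hs, hcont, fun b hb hd => ?_, fun r hr h => ?_, fun r hr h => ?_, hneg, hpos⟩
  · refine contDiffAt_of_implicit (hu.contDiffAt (isOpen_Ioo.mem_nhds (hJ hb)))
      (hv.contDiffAt (isOpen_Ioo.mem_nhds (hs b hb))) (hcont.continuousAt (hJo.mem_nhds hb)) ?_ hd
    filter_upwards [hJo.mem_nhds hb] with b' hb'
    exact eq_zero_at_sign_boundary hv.continuousOn (hs b' hb') (hneg b' hb') (hpos b' hb')
  · have hur := hu.continuousOn.continuousAt (isOpen_Ioo.mem_nhds hr)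
    refine tendsto_order.2 ⟨fun a ha => ?_, fun a ha => ?_⟩
    · obtain ⟨t, ht1, ht2⟩ := exists_between (max_lt ha zero_lt_one)
      have ht : t ∈ Ioo (0 : ℝ) 1 := ⟨(le_max_right _ _).trans_lt ht1, ht2⟩
      filter_upwards [eventually_le_of_neg hur ht hpos (h t ht)] with b hb
      exact (le_max_left _ _).trans_lt (ht1.trans_le hb)
    · filter_upwards [self_mem_nhdsWithin] with b hb
      exact (hs b hb).2.trans ha
  · have hur := hu.continuousOn.continuousAt (isOpen_Ioo.mem_nhds hr)
    refine tendsto_order.2 ⟨fun a ha => ?_, fun a ha => ?_⟩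
    · filter_upwards [self_mem_nhdsWithin] with b hb
      exact ha.trans (hs b hb).1
    · obtain ⟨t, ht1, ht2⟩ := exists_between (lt_min ha zero_lt_one)
      have ht : t ∈ Ioo (0 : ℝ) 1 := ⟨ht1, ht2.trans_le (min_le_right _ _)⟩
      filter_upwards [eventually_ge_of_pos hur ht hneg (h t ht)] with b hb
      exact hb.trans_lt (ht2.trans_le (min_le_left _ _))

end SignChange

/-! ### Multipliers of the fibre diffeomorphisms. -/

section Fiber

theorem realExt_coe (g : I → I) (y : I) : realExt g y = g y := IccExtend_val _ _ y

theorem realExt_mem (g : I → I) (t : ℝ) : realExt g t ∈ Icc (0 : ℝ) 1 := (g _).2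

theorem continuous_of_continuousOn_realExt {g : I → I} (h : ContinuousOn (realExt g) (Icc 0 1)) :
    Continuous g := by
  rw [continuous_induced_rng]
  have := h.domRestrict
  refine this.congr fun y => ?_
  exact realExt_coe g y

theorem IsC2Diffeo.continuous {g : I ≃ I} (h : IsC2Diffeo g) : Continuous g :=
  continuous_of_continuousOn_realExt h.1.continuousOn

theorem IsC2Diffeo.hasDerivWithinAt {g : I ≃ I} (h : IsC2Diffeo g) (j : I) :
    HasDerivWithinAt (realExt g) (fiberDeriv g j) (Icc 0 1) j :=
  ((h.1.differentiableOn (by norm_num)) j j.2).hasDerivWithinAt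

/-- A vanishing derivative would give `0 = 1` in the chain rule for the inverse composed with `g`.
-/
theorem IsC2Diffeo.fiberDeriv_ne_zero {g : I ≃ I} (h : IsC2Diffeo g) (j : I) :
    fiberDeriv g j ≠ 0 := by
  intro h0
  have h1 := h.hasDerivWithinAt j
  rw [h0] at h1
  have h2 : HasDerivWithinAt (realExt g.symm) (fiberDeriv g.symm (g j)) (Icc 0 1) (realExt g j) := by
    rw [realExt_coe]
    exact ((h.2.differentiableOn (by norm_num)) (g j) (g j).2).hasDerivWithinAt
  have h3 := h2.comp (j : ℝ) h1 (fun t _ => realExt_mem g t)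
  have h4 : HasDerivWithinAt (realExt g.symm ∘ realExt g) 1 (Icc 0 1) (j : ℝ) := by
    refine (hasDerivWithinAt_id (j : ℝ) (Icc 0 1)).congr_of_mem (fun t ht => ?_) j.2
    have e : realExt g t = g ⟨t, ht⟩ := realExt_coe g ⟨t, ht⟩
    simp only [Function.comp_apply, e, realExt_coe, Equiv.symm_apply_apply, id]
  have := (uniqueDiffOn_Icc_zero_one (j : ℝ) j.2).eq_deriv _ h3 h4
  simp at this

theorem IsC2Diffeo.hasLogMultiplier {g : I ≃ I} (h : IsC2Diffeo g) {j : I} (hj : g j = j) :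
    HasLogMultiplier g j (Real.log (fiberDeriv g j)) := by
  refine ⟨hj, fun ε hε => ?_⟩
  have ha : 0 < |fiberDeriv g j| := abs_pos.2 (h.fiberDeriv_ne_zero j)
  have hexp : ∀ c, Real.exp (Real.log (fiberDeriv g j) + c) = |fiberDeriv g j| * Real.exp c :=
    fun c => by rw [Real.exp_add, Real.exp_log_eq_abs (h.fiberDeriv_ne_zero j)]
  have h1 : Real.exp (-ε) < 1 := by rw [Real.exp_lt_one_iff]; linarith
  have h2 : 1 < Real.exp ε := Real.one_lt_exp_iff.2 hε
  -- With this slope error, `|g'(j)| ± c` stays between `|g'(j)| exp(-ε)` and `|g'(j)| exp ε`. As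
  -- `Real.log` sees only absolute values, the sign of `g'(j)` plays no role.
  set c := |fiberDeriv g j| * min (1 - Real.exp (-ε)) (Real.exp ε - 1)
  have hc : 0 < c := mul_pos ha (lt_min (by linarith) (by linarith))
  have hc1 : c ≤ |fiberDeriv g j| * (1 - Real.exp (-ε)) :=
    mul_le_mul_of_nonneg_left (min_le_left _ _) ha.le
  have hc2 : c ≤ |fiberDeriv g j| * (Real.exp ε - 1) :=
    mul_le_mul_of_nonneg_left (min_le_right _ _) ha.le
  have hlit := (hasDerivWithinAt_iff_isLittleO.1 (h.hasDerivWithinAt j)).def hc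
  obtain ⟨δ, hδ, H⟩ := Metric.mem_nhdsWithin_iff.1 hlit
  refine ⟨δ, hδ, fun y hy => ?_⟩
  have hH : ‖realExt g y - realExt g j - ((y : ℝ) - j) • fiberDeriv g j‖ ≤ c * ‖(y : ℝ) - j‖ :=
    H ⟨hy, y.2⟩
  rw [realExt_coe, realExt_coe, hj, smul_eq_mul, Real.norm_eq_abs, Real.norm_eq_abs] at hH
  rw [Subtype.dist_eq, Subtype.dist_eq, Real.dist_eq, Real.dist_eq, sub_eq_add_neg _ ε, hexp, hexp]
  have hm : |((y : ℝ) - j) * fiberDeriv g j| = |fiberDeriv g j| * |(y : ℝ) - j| := by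
    rw [abs_mul, mul_comm]
  have t1 := abs_sub_abs_le_abs_sub ((g y : ℝ) - j) (((y : ℝ) - j) * fiberDeriv g j)
  have t2 := abs_sub_abs_le_abs_sub (((y : ℝ) - j) * fiberDeriv g j) ((g y : ℝ) - j)
  rw [abs_sub_comm (((y : ℝ) - j) * fiberDeriv g j)] at t2
  have k1 := mul_le_mul_of_nonneg_right hc1 (abs_nonneg ((y : ℝ) - j))
  have k2 := mul_le_mul_of_nonneg_right hc2 (abs_nonneg ((y : ℝ) - j))
  constructor <;> nlinarith

end Fiber

/-! ### Assembly for the two segments. -/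

/-- The attractor alternative for a segment: for negative normal exponent the segment is an
essential Milnor attractor with locally riddled basin. -/
theorem attractor_of_logAlpha_neg {g₁ g₂ : ℝ → (I ≃ I)} {j : I} {β₁ β₂ : ℝ}
    (d₁ : IsC2Diffeo (g₁ β₁)) (d₂ : IsC2Diffeo (g₂ β₂)) (f₁ : g₁ β₁ j = j) (f₂ : g₂ β₂ j = j)
    {c : ℝ} (hc : 0 < c)
    (hrep : ∀ y, 0 < dist y j → dist y j ≤ c → dist y j < dist (g₂ β₂ y) j)
    (h : Real.log (fiberDeriv (g₁ β₁) j) + Real.log (fiberDeriv (g₂ β₂) j) < 0) :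
    IsMilnorAttractor (skewProduct (g₁ β₁) (g₂ β₂)) (segmentAt j) ∧
      IsEssentialAttractor (skewProduct (g₁ β₁) (g₂ β₂)) (segmentAt j) ∧
      HasLocallyRiddledBasin (skewProduct (g₁ β₁) (g₂ β₂)) (segmentAt j) :=
  ⟨isMilnorAttractor_segmentAt (d₁.hasLogMultiplier f₁) (d₂.hasLogMultiplier f₂) h,
    isEssentialAttractor_segmentAt (d₁.hasLogMultiplier f₁) (d₂.hasLogMultiplier f₂) h,
    hasLocallyRiddledBasin_segmentAt (d₁.hasLogMultiplier f₁) (d₂.hasLogMultiplier f₂) h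
      d₁.continuous d₂.continuous (g₁ β₁).injective (g₂ β₂).injective hc hrep⟩

theorem logAlpha_eq {g₁ g₂ : ℝ → (I ≃ I)} (h₁ : IsFiberFamily g₁) (h₂ : IsFiberFamily g₂) (j : I)
    {β₁ β₂ : ℝ} (hβ₁ : β₁ ∈ Ioo (0 : ℝ) 1) (hβ₂ : β₂ ∈ Ioo (0 : ℝ) 1) :
    logAlpha g₁ g₂ j β₁ β₂ =
      Real.log (fiberDeriv (g₁ β₁) j) + Real.log (fiberDeriv (g₂ β₂) j) :=
  Real.log_mul ((h₁.diffeo _ hβ₁).fiberDeriv_ne_zero j) ((h₂.diffeo _ hβ₂).fiberDeriv_ne_zero j)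

theorem deriv_logAlpha {g₁ g₂ : ℝ → (I ≃ I)} (h₁ : IsFiberFamily g₁) (h₂ : IsFiberFamily g₂)
    (j : I) {β₁ β₂ : ℝ} (hβ₁ : β₁ ∈ Ioo (0 : ℝ) 1) (hβ₂ : β₂ ∈ Ioo (0 : ℝ) 1) :
    deriv (fun t => logAlpha g₁ g₂ j β₁ t) β₂ =
      deriv (fun t => Real.log (fiberDeriv (g₂ t) j)) β₂ := by
  have : (fun t => logAlpha g₁ g₂ j β₁ t) =ᶠ[𝓝 β₂]
      fun t => Real.log (fiberDeriv (g₁ β₁) j) + Real.log (fiberDeriv (g₂ t) j) := by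
    filter_upwards [isOpen_Ioo.mem_nhds hβ₂] with t ht
    exact logAlpha_eq h₁ h₂ j hβ₁ ht
  rw [this.deriv_eq, deriv_const_add]

theorem IsFiberFamily.contDiffOn_log {g : ℝ → (I ≃ I)} (h : IsFiberFamily g) {j : I}
    (hs : ContDiffOn ℝ ∞ (fun β => fiberDeriv (g β) j) (Ioo 0 1)) :
    ContDiffOn ℝ ∞ (fun β => Real.log (fiberDeriv (g β) j)) (Ioo 0 1) :=
  hs.log fun β hβ => (h.diffeo β hβ).fiberDeriv_ne_zero j

/-- This is the repulsion that feeds the riddling argument; `β / 2` keeps the strip strictly below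
the fixed point `β`. -/
theorem AttractsToParam.dist_zero_lt {g : ℝ → (I ≃ I)} (h : AttractsToParam g) {β : ℝ}
    (hβ : β ∈ Ioo (0 : ℝ) 1) (y : I) (hy : 0 < dist y 0) (hyβ : dist y 0 ≤ β / 2) :
    dist y 0 < dist (g β y) 0 := by
  simp only [Subtype.dist_eq, Real.dist_eq, Icc.coe_zero, sub_zero, abs_of_nonneg y.2.1,
    abs_of_nonneg (g β y).2.1] at hy hyβ ⊢
  exact (h β hβ y).1 hy (by linarith [hβ.1])

theorem AttractsToParam.dist_one_lt {g : ℝ → (I ≃ I)} (h : AttractsToParam g) {β : ℝ}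
    (hβ : β ∈ Ioo (0 : ℝ) 1) (y : I) (hy : 0 < dist y 1) (hyβ : dist y 1 ≤ (1 - β) / 2) :
    dist y 1 < dist (g β y) 1 := by
  simp only [Subtype.dist_eq, Real.dist_eq, Icc.coe_one, abs_sub_comm _ (1 : ℝ),
    abs_of_nonneg (sub_nonneg.2 y.2.2), abs_of_nonneg (sub_nonneg.2 (g β y).2.2)] at hy hyβ ⊢
  have : (g β y : ℝ) < y := (h β hβ y).2 (by linarith [hβ.2]) (by linarith)
  linarith

end RiddledSkew

theorem theorem3p6 (g₁ g₂ : ℝ → (I ≃ I))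
    (h₁ : IsFiberFamily g₁) (h₂ : IsFiberFamily g₂)
    (hI2 : RepelsFromParam g₁) (hI3 : AttractsToParam g₂) :
    (∀ r ∈ Ioo (0 : ℝ) 1,
      (∀ β₁ ∈ Ioo 0 r, ChangesNegToPos (fun β₂ => logAlpha g₁ g₂ 0 β₁ β₂)) →
      ∃ ξ : ℝ → ℝ, ξ r = 1 ∧
        MapsTo ξ (Ioo 0 r) (Ioo 0 1) ∧
        ContinuousOn ξ (Ioo 0 r) ∧
        (∀ β₁ ∈ Ioo 0 r, deriv (fun β₂ => logAlpha g₁ g₂ 0 β₁ β₂) (ξ β₁) ≠ 0 →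
          ContDiffAt ℝ ∞ ξ β₁) ∧
        ((∀ β₂ ∈ Ioo (0 : ℝ) 1, logAlpha g₁ g₂ 0 r β₂ < 0) →
          ContinuousWithinAt ξ (Ioc 0 r) r) ∧
        ∀ β₁ ∈ Ioo 0 r, ∀ β₂ ∈ Ioo (0 : ℝ) 1,
          (β₂ < ξ β₁ →
            IsMilnorAttractor (skewProduct (g₁ β₁) (g₂ β₂)) (segmentAt 0) ∧
            IsEssentialAttractor (skewProduct (g₁ β₁) (g₂ β₂)) (segmentAt 0) ∧
            HasLocallyRiddledBasin (skewProduct (g₁ β₁) (g₂ β₂)) (segmentAt 0)) ∧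
          (ξ β₁ < β₂ →
            IsChaoticSaddle (skewProduct (g₁ β₁) (g₂ β₂)) (segmentAt 0))) ∧
    (∀ l ∈ Ioo (0 : ℝ) 1,
      (∀ β₁ ∈ Ioo l 1, ChangesPosToNeg (fun β₂ => logAlpha g₁ g₂ 1 β₁ β₂)) →
      ∃ ζ : ℝ → ℝ, ζ l = 0 ∧
        MapsTo ζ (Ioo l 1) (Ioo 0 1) ∧
        ContinuousOn ζ (Ioo l 1) ∧
        (∀ β₁ ∈ Ioo l 1, deriv (fun β₂ => logAlpha g₁ g₂ 1 β₁ β₂) (ζ β₁) ≠ 0 →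
          ContDiffAt ℝ ∞ ζ β₁) ∧
        ((∀ β₂ ∈ Ioo (0 : ℝ) 1, logAlpha g₁ g₂ 1 l β₂ < 0) →
          ContinuousWithinAt ζ (Ico l 1) l) ∧
        ∀ β₁ ∈ Ioo l 1, ∀ β₂ ∈ Ioo (0 : ℝ) 1,
          (ζ β₁ < β₂ →
            IsMilnorAttractor (skewProduct (g₁ β₁) (g₂ β₂)) (segmentAt 1) ∧
            IsEssentialAttractor (skewProduct (g₁ β₁) (g₂ β₂)) (segmentAt 1) ∧
            HasLocallyRiddledBasin (skewProduct (g₁ β₁) (g₂ β₂)) (segmentAt 1)) ∧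
          (β₂ < ζ β₁ →
            IsChaoticSaddle (skewProduct (g₁ β₁) (g₂ β₂)) (segmentAt 1))) := by
  constructor
  · intro r hr hch
    have hsub : Ioo 0 r ⊆ Ioo (0 : ℝ) 1 := Ioo_subset_Ioo_right hr.2.le
    obtain ⟨s, hs, hcont, hsm, hlim, -, hneg, hpos⟩ := exists_sign_boundary isOpen_Ioo hsub
      (h₁.contDiffOn_log h₁.smooth_zero) (h₂.contDiffOn_log h₂.smooth_zero) (fun b hb => by
        obtain ⟨t₀, ht₀, hn, hp⟩ := hch b hb
        refine ⟨t₀, ht₀, fun t ht => ?_, fun t ht => ?_⟩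
        · exact (logAlpha_eq h₁ h₂ 0 (hsub hb) ⟨ht.1, ht.2.trans ht₀.2⟩).symm.trans_lt (hn t ht)
        · exact (hp t ht).trans_eq (logAlpha_eq h₁ h₂ 0 (hsub hb) ⟨ht₀.1.trans ht.1, ht.2⟩))
    -- The boundary function is unconstrained at `r`, so the value `1` is imposed there without
    -- affecting the open interval.
    have heq : ∀ b ∈ Ioo 0 r, Function.update s r 1 b = s b :=
      fun b hb => Function.update_of_ne hb.2.ne _ _
    refine ⟨Function.update s r 1, Function.update_self _ _ _, fun b hb => heq b hb ▸ hs hb,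
      hcont.congr heq, fun b hb hd => ?_, fun h => ?_, fun b hb t ht => ?_⟩
    · rw [heq b hb, deriv_logAlpha h₁ h₂ 0 (hsub hb) (hs hb)] at hd
      exact (hsm b hb hd).congr_of_eventuallyEq
        (eventuallyEq_of_mem (isOpen_Ioo.mem_nhds hb) heq)
    · rw [continuousWithinAt_update_same]
      have : Ioc 0 r \ {r} = Ioo 0 r := Ioc_sdiff_right
      rw [this]
      exact hlim r hr fun t ht => logAlpha_eq h₁ h₂ 0 hr ht ▸ h t ht
    · rw [heq b hb]
      have d₁ := h₁.diffeo b (hsub hb)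
      have d₂ := h₂.diffeo t ht
      have f₁ := h₁.fix_zero b (hsub hb)
      have f₂ := h₂.fix_zero t ht
      exact ⟨fun hlt => attractor_of_logAlpha_neg d₁ d₂ f₁ f₂ (half_pos ht.1)
          (hI3.dist_zero_lt ht) (hneg b hb t ht hlt),
        fun hlt => isChaoticSaddle_segmentAt (d₁.hasLogMultiplier f₁) (d₂.hasLogMultiplier f₂)
          (g₁ b).injective (g₂ t).injective (hpos b hb t ht hlt)⟩
  · intro l hl hch
    have hsub : Ioo l 1 ⊆ Ioo (0 : ℝ) 1 := Ioo_subset_Ioo_left hl.1.le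
    -- Negation turns the positive-to-negative change into the negative-to-positive one; `hneg` and
    -- `hpos` below therefore speak of `-log α¹`.
    obtain ⟨s, hs, hcont, hsm, -, hlim, hneg, hpos⟩ := exists_sign_boundary isOpen_Ioo hsub
      (h₁.contDiffOn_log h₁.smooth_one).neg (h₂.contDiffOn_log h₂.smooth_one).neg (fun b hb => by
        obtain ⟨t₀, ht₀, hp, hn⟩ := hch b hb
        refine ⟨t₀, ht₀, fun t ht => ?_, fun t ht => ?_⟩
        · have := (hp t ht).trans_eq (logAlpha_eq h₁ h₂ 1 (hsub hb) ⟨ht.1, ht.2.trans ht₀.2⟩)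
          linarith
        · have := (logAlpha_eq h₁ h₂ 1 (hsub hb) ⟨ht₀.1.trans ht.1, ht.2⟩).symm.trans_lt (hn t ht)
          linarith)
    have heq : ∀ b ∈ Ioo l 1, Function.update s l 0 b = s b :=
      fun b hb => Function.update_of_ne hb.1.ne' _ _
    refine ⟨Function.update s l 0, Function.update_self _ _ _, fun b hb => heq b hb ▸ hs hb,
      hcont.congr heq, fun b hb hd => ?_, fun h => ?_, fun b hb t ht => ?_⟩
    · rw [heq b hb, deriv_logAlpha h₁ h₂ 1 (hsub hb) (hs hb)] at hd
      refine (hsm b hb ?_).congr_of_eventuallyEq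
        (eventuallyEq_of_mem (isOpen_Ioo.mem_nhds hb) heq)
      rw [deriv.fun_neg]
      exact neg_ne_zero.2 hd
    · rw [continuousWithinAt_update_same]
      have : Ico l 1 \ {l} = Ioo l 1 := Ico_sdiff_left
      rw [this]
      refine hlim l hl fun t ht => ?_
      have := logAlpha_eq h₁ h₂ 1 hl ht ▸ h t ht
      linarith
    · rw [heq b hb]
      have d₁ := h₁.diffeo b (hsub hb)
      have d₂ := h₂.diffeo t ht
      have f₁ := h₁.fix_one b (hsub hb)
      have f₂ := h₂.fix_one t ht
      exact ⟨fun hlt => attractor_of_logAlpha_neg d₁ d₂ f₁ f₂ (half_pos (sub_pos.2 ht.2))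
          (hI3.dist_one_lt ht) (by linarith [hpos b hb t ht hlt]),
        fun hlt => isChaoticSaddle_segmentAt (d₁.hasLogMultiplier f₁) (d₂.hasLogMultiplier f₂)
          (g₁ b).injective (g₂ t).injective (by linarith [hneg b hb t ht hlt])⟩
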